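/- Let $\mathbb K$ be $\mathbb R$ or $\mathbb C$, and let $(x_i,y_i)\in\mathbb P^2\times\mathbb P^2$, $i=1,\dots,5$, be point pairs over $\mathbb K$, given by arbitrary nonzero coordinate vectors in $\mathbb K^3$. Let $Z_5$ be the $5\times 9$ matrix with rows $x_i^\top\otimes y_i^\top$. We say that an inherited condition holds if, for some $l<5$, some $l$ of the rows of $Z_5$ form a matrix of rank less than $l$. Write $[ijl]_x$ for the determinant of the $3\times3$ matrix with rows $x_i^\top,x_j^\top,x_l^\top$. If all $y_i$ lie on a line, choose a homography $H\in \mathrm{GL}_3(\mathbb K)$ taking all $y_i$ to the line $(*,*,0)$ and write $[ij]_y$ for the determinant of the $2\times 2$ matrix whose rows are the first two coordinates of $Hy_i$ and $Hy_j$. Define $[ijl]_y$ and, if the $x_i$ lie on a line, $[ij]_x$ in the same way. (1) $\operatorname{rank} Z_5<5$ if and only if an inherited condition holds, or the $y_i$ lie on a line and $$[i_1i_3j]_x[i_2i_4j]_x[i_1i_4]_y[i_2i_3]_y=[i_1i_4j]_x[i_2i_3j]_x[i_1i_3]_y[i_2i_4]_y\qquad(*)$$ for all distinct $i_1,i_2,i_3,i_4,j\in\{1,\dots,5\}$,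 or the same holds with the roles of $x$ and $y$ exchanged. In the remaining parts the $y_i$ lie on a line; the same statements hold with $x$ and $y$ exchanged. (2) Whether $(*)$ holds does not depend on the choice of $H$. For each fixed $j$, the equations $(*)$ for all orderings of the other four indices are equivalent to one another, so there are only five equations to consider, one for each $j$. (3) If the $x_i$ lie on a line as well, then $(*)$ holds for all distinct $i_1,i_2,i_3,i_4,j$. (4) Generically, namely if no three of the $x_i$ are collinear and the $y_i$ are distinct (a Zariski-open condition, satisfied by some configuration with the $y_i$ on a line), $(*)$ is equivalent, for all distinct $i_1,i_2,i_3,i_4,j$, to the equality of the planar cross-ratio of the $x$'s and the line cross-ratio of the $y$'s: $$\frac{[i_1i_3j]_x[i_2i_4j]_x}{[i_1i_4j]_x[i_2i_3j]_x}=\frac{[i_1i_3]_y[i_2i_4]_y}{[i_1i_4]_y[i_2i_3]_y}.$$ -/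

import Mathlib

/-- The points `p i` of the projective plane over `𝕜` lie on a common projective line
(a line is the projectivization of a two-dimensional subspace). -/
def OnLine {𝕜 ι : Type*} [Field 𝕜] (p : ι → Projectivization 𝕜 (Fin 3 → 𝕜)) : Prop :=
  ∃ L : Submodule 𝕜 (Fin 3 → 𝕜), Module.finrank 𝕜 L = 2 ∧ ∀ i, (p i).submodule ≤ L

/-- `X` is a choice of (nonzero) coordinate vectors for the points `p i`. -/
def Represents {𝕜 ι : Type*} [Field 𝕜] (X : ι → Fin 3 → 𝕜)
    (p : ι → Projectivization 𝕜 (Fin 3 → 𝕜)) : Prop :=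
  ∀ i, ∃ h : X i ≠ 0, Projectivization.mk 𝕜 (X i) h = p i

/-- The matrix with rows `X i ⊗ Y i`; its nine columns are indexed by `Fin 3 × Fin 3`. -/
def faceSplit {𝕜 ι : Type*} [Field 𝕜] (X Y : ι → Fin 3 → 𝕜) : Matrix ι (Fin 3 × Fin 3) 𝕜 :=
  Matrix.of fun i c => X i c.1 * Y i c.2

/-- An inherited condition holds: the rows indexed by some proper subset `S` of the point pairs
already form a matrix of rank less than the number of its rows. -/
def Inherited {𝕜 : Type*} [Field 𝕜] {k : ℕ} (X Y : Fin k → Fin 3 → 𝕜) : Prop :=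
  ∃ S : Finset (Fin k), S ≠ Finset.univ ∧
    (faceSplit (fun i : S => X i) (fun i : S => Y i)).rank < S.card

/-- The planar bracket `[i j l]`. -/
def bracket₃ {𝕜 ι : Type*} [Field 𝕜] (X : ι → Fin 3 → 𝕜) (i j l : ι) : 𝕜 :=
  (Matrix.of ![X i, X j, X l]).det

/-- The bracket `[i j]` of points of the projective line. -/
def bracket₂ {𝕜 ι : Type*} [Field 𝕜] (V : ι → Fin 2 → 𝕜) (i j : ι) : 𝕜 :=
  (Matrix.of ![V i, V j]).det

/-- The homography `H` moves all the points `Y i` to the line `(*, *, 0)`. -/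
def Flattens {𝕜 ι : Type*} [Field 𝕜] (H : GL (Fin 3) 𝕜) (Y : ι → Fin 3 → 𝕜) : Prop :=
  ∀ i, (H.val.mulVec (Y i)) 2 = 0

/-- The coordinates on the projective line of points moved to the line `(*, *, 0)` by `H`:
the last coordinate is dropped. -/
def lineCoords {𝕜 ι : Type*} [Field 𝕜] (H : GL (Fin 3) 𝕜) (Y : ι → Fin 3 → 𝕜) :
    ι → Fin 2 → 𝕜 :=
  fun i => ![(H.val.mulVec (Y i)) 0, (H.val.mulVec (Y i)) 1]

/-- The bracket equation
`[i₁ i₃ j]_x [i₂ i₄ j]_x [i₁ i₄]_y [i₂ i₃]_y = [i₁ i₄ j]_x [i₂ i₃ j]_x [i₁ i₃]_y [i₂ i₄]_y`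
between points `X` of the plane and points `V` of the line. -/
def BracketEq {𝕜 ι : Type*} [Field 𝕜] (X : ι → Fin 3 → 𝕜) (V : ι → Fin 2 → 𝕜)
    (i₁ i₂ i₃ i₄ j : ι) : Prop :=
  bracket₃ X i₁ i₃ j * bracket₃ X i₂ i₄ j * bracket₂ V i₁ i₄ * bracket₂ V i₂ i₃ =
    bracket₃ X i₁ i₄ j * bracket₃ X i₂ i₃ j * bracket₂ V i₁ i₃ * bracket₂ V i₂ i₄

/-- The bracket equations for all distinct indices. -/
def AllBracketEqs {𝕜 ι : Type*} [Field 𝕜] (X : ι → Fin 3 → 𝕜) (V : ι → Fin 2 → 𝕜) : Prop :=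
  ∀ i₁ i₂ i₃ i₄ j : ι, [i₁, i₂, i₃, i₄, j].Nodup → BracketEq X V i₁ i₂ i₃ i₄ j

/-- The cross-ratio `(i₁, i₂; i₃, i₄)` on the projective line. -/
def lineCrossRatio {𝕜 ι : Type*} [Field 𝕜] (V : ι → Fin 2 → 𝕜) (i₁ i₂ i₃ i₄ : ι) : 𝕜 :=
  bracket₂ V i₁ i₃ * bracket₂ V i₂ i₄ / (bracket₂ V i₁ i₄ * bracket₂ V i₂ i₃)

/-- The planar cross-ratio `(i₁, i₂; i₃, i₄; j)` around the point with index `j`. -/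
def planarCrossRatio {𝕜 ι : Type*} [Field 𝕜] (X : ι → Fin 3 → 𝕜) (i₁ i₂ i₃ i₄ j : ι) : 𝕜 :=
  bracket₃ X i₁ i₃ j * bracket₃ X i₂ i₄ j / (bracket₃ X i₁ i₄ j * bracket₃ X i₂ i₃ j)

/-- Genericity of a configuration: no three of the `x i` are collinear, and the `y i` are
distinct. This is a Zariski-open condition, under which no bracket with distinct indices
vanishes, so that all cross-ratios are defined. -/
def Generic {𝕜 ι : Type*} [Field 𝕜] (x y : ι → Projectivization 𝕜 (Fin 3 → 𝕜)) : Prop :=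
  (∀ i j l : ι, [i, j, l].Nodup → ¬ OnLine ![x i, x j, x l]) ∧ Function.Injective y

/-! Rank less than 5 means a nontrivial relation `∑ g i • (x_i ⊗ y_i) = 0`. Relations with a zero
coefficient are exactly the inherited conditions (`inherited_iff`). If no coefficient vanishes, then
`Xᵀ diag(g) Y = 0`, so the ranks of `X` and `Y` add up to at most 5 and one side is collinear
(`exists_annihilator_of_sum_eq_zero`).

Let the `y_i` be collinear, with line coordinates `v_i`. Projecting the `x_i` from `x_j` kills the
term `j` and leaves four dependent vectors in `K² ⊗ K²`. The 4×4 determinant that expresses this is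
the difference of the two sides of (*) (`segreMatrix_det`).

Conversely, (*) around `j` gives a nonzero bilinear form on `K³ × K²` that vanishes on all pairs and
is singular at `x_j`. If the 5×6 matrix of the `x_i ⊗ v_i` had rank 5, these five forms would be
proportional, so one form `B` would be singular at every `x_i`. A nonzero column `n` of `B` would
then annihilate all `x_i`, and the products `n ⊗ w` would form a two-dimensional space inside a
one-dimensional kernel (`planeLineMatrix_rank_lt`). -/

/-! ### Rank deficiency and kernels -/

open Matrix in
/-- A matrix is rank deficient in its rows exactly when the rows satisfy a nontrivial relation. -/
theorem rank_lt_card_iff_exists_vecMul {K m n : Type*} [Field K] [Fintype m] [Fintype n]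
    (M : Matrix m n K) : M.rank < Fintype.card m ↔ ∃ g : m → K, g ≠ 0 ∧ g ᵥ* M = 0 := by
  have h1 : M.rank < Fintype.card m ↔ ¬ LinearIndependent K M.row := by
    rw [linearIndependent_iff_card_eq_finrank_span, Set.finrank,
      ← Matrix.rank_eq_finrank_span_row]
    have := Matrix.rank_le_card_height M
    omega
  rw [h1, ← Matrix.vecMul_injective_iff, ← Matrix.coe_vecMulLinear,
    injective_iff_map_eq_zero]
  push Not
  exact ⟨fun ⟨g, h, h'⟩ => ⟨g, h', h⟩, fun ⟨g, h, h'⟩ => ⟨g, h', h⟩⟩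

open Matrix in
/-- A matrix is rank deficient in its columns exactly when its kernel is nontrivial. -/
theorem rank_lt_card_iff_exists_mulVec {K m n : Type*} [Field K] [Fintype m] [Fintype n]
    (M : Matrix m n K) : M.rank < Fintype.card n ↔ ∃ v : n → K, v ≠ 0 ∧ M *ᵥ v = 0 := by
  simp_rw [← Matrix.rank_transpose M, rank_lt_card_iff_exists_vecMul, Matrix.vecMul_transpose]

open Matrix in
/-- If the kernel of a matrix is at most one-dimensional, its elements are proportional. -/
theorem exists_smul_eq_of_mulVec_eq_zero {K m n : Type*} [Field K] [Fintype n]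
    {M : Matrix m n K} (hM : Fintype.card n ≤ M.rank + 1) {v w : n → K}
    (hv : v ≠ 0) (hMv : M *ᵥ v = 0) (hMw : M *ᵥ w = 0) : ∃ c : K, c • v = w := by
  have h := LinearMap.finrank_range_add_finrank_ker M.mulVecLin
  rw [← Matrix.rank, Module.finrank_fintype_fun_eq_card] at h
  have hne : (⟨v, by simpa using hMv⟩ : LinearMap.ker M.mulVecLin) ≠ 0 := by
    simpa [Subtype.ext_iff] using hv
  have hpos := (Module.finrank_pos_iff_exists_ne_zero (R := K)).2 ⟨_, hne⟩
  obtain ⟨c, hc⟩ := (finrank_eq_one_iff_of_nonzero' _ hne).1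
    (le_antisymm (by omega) hpos) ⟨w, by simpa using hMw⟩
  exact ⟨c, congrArg Subtype.val hc⟩

section Field

variable {K : Type*} [Field K]

/-! ### Relations between the rows and inherited conditions -/

theorem vecMul_faceSplit_eq_zero_iff {ι : Type*} [Fintype ι] (X Y : ι → Fin 3 → K) (g : ι → K) :
    Matrix.vecMul g (faceSplit X Y) = 0 ↔ ∀ a b, ∑ i, g i * (X i a * Y i b) = 0 := by
  simp [funext_iff, Matrix.vecMul, dotProduct, faceSplit]

theorem faceSplit_rank_lt_iff {ι : Type*} [Fintype ι] (X Y : ι → Fin 3 → K) :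
    (faceSplit X Y).rank < Fintype.card ι ↔
      ∃ g : ι → K, g ≠ 0 ∧ ∀ a b, ∑ i, g i * (X i a * Y i b) = 0 := by
  simp_rw [rank_lt_card_iff_exists_vecMul, vecMul_faceSplit_eq_zero_iff]

theorem faceSplit_rank_lt_five_iff_exists (X Y : Fin 5 → Fin 3 → K) :
    (faceSplit X Y).rank < 5 ↔
      ∃ g : Fin 5 → K, g ≠ 0 ∧ ∀ a b, ∑ i, g i * (X i a * Y i b) = 0 := by
  simpa using faceSplit_rank_lt_iff X Y

/-- A relation on a proper subset extends by zero; conversely, an index with zero coefficient can be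
dropped. -/
theorem inherited_iff {k : ℕ} (X Y : Fin k → Fin 3 → K) :
    Inherited X Y ↔ ∃ g : Fin k → K, g ≠ 0 ∧ (∃ i, g i = 0) ∧
      ∀ a b, ∑ i, g i * (X i a * Y i b) = 0 := by
  constructor
  · rintro ⟨S, hS, h⟩
    rw [← Fintype.card_coe, faceSplit_rank_lt_iff] at h
    obtain ⟨g, hg, h⟩ := h
    obtain ⟨i₀, hi₀⟩ : ∃ i, i ∉ S := by simpa [Finset.eq_univ_iff_forall] using hS
    refine ⟨fun i => if hi : i ∈ S then g ⟨i, hi⟩ else 0, fun h0 => hg ?_, ⟨i₀, by simp [hi₀]⟩,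
      fun a b => ?_⟩
    · ext i
      simpa using congrFun h0 i
    · rw [← Finset.sum_subset S.subset_univ (fun i _ hi => by simp [hi]),
        ← Finset.sum_coe_sort S]
      refine Eq.trans ?_ (h a b)
      exact Finset.sum_congr rfl fun i _ => by simp
  · rintro ⟨g, hg, ⟨i₀, hi₀⟩, h⟩
    refine ⟨Finset.univ.erase i₀, fun h' => ?_, ?_⟩
    · simpa using congrArg (i₀ ∈ ·) h'
    · rw [← Fintype.card_coe, faceSplit_rank_lt_iff]
      refine ⟨fun i => g i, fun h0 => hg ?_, fun a b => ?_⟩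
      · ext i
        by_cases hi : i = i₀
        · simp [hi, hi₀]
        · simpa using congrFun h0 ⟨i, by simp [hi]⟩
      · rw [← h a b, Finset.sum_coe_sort (Finset.univ.erase i₀) fun i => g i * (X i a * Y i b)]
        exact Finset.sum_erase _ (by simp [hi₀])

/-! ### Collinearity, brackets and cross products -/

theorem submodule_le_iff {p : Projectivization K (Fin 3 → K)} {v : Fin 3 → K} {hv : v ≠ 0}
    (h : Projectivization.mk K v hv = p) (L : Submodule K (Fin 3 → K)) :
    p.submodule ≤ L ↔ v ∈ L := by
  rw [← h, Projectivization.submodule_mk, Submodule.span_singleton_le_iff_mem]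

open Matrix in
/-- Points lie on a line exactly when their coordinates satisfy a nontrivial linear equation. -/
theorem onLine_iff {ι : Type*} {p : ι → Projectivization K (Fin 3 → K)} {X : ι → Fin 3 → K}
    (h : Represents X p) : OnLine p ↔ ∃ n : Fin 3 → K, n ≠ 0 ∧ ∀ i, n ⬝ᵥ X i = 0 := by
  have hL (L : Submodule K (Fin 3 → K)) (i) : (p i).submodule ≤ L ↔ X i ∈ L := by
    obtain ⟨_, hi⟩ := h i
    exact submodule_le_iff hi L
  simp_rw [OnLine, hL]
  constructor
  · rintro ⟨L, hL2, hX⟩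
    have hlt : L < ⊤ := lt_top_iff_ne_top.2 fun h => by
      rw [h, finrank_top, Module.finrank_fin_fun] at hL2
      omega
    obtain ⟨f, hf, hle⟩ := L.exists_le_ker_of_lt_top hlt
    have hfn (v : Fin 3 → K) : (fun a => f (Pi.single a 1)) ⬝ᵥ v = f v := by
      rw [dotProduct_comm]
      conv_rhs => rw [pi_eq_sum_univ' v]
      simp [dotProduct, map_sum]
    refine ⟨fun a => f (Pi.single a 1), fun h0 => hf ?_, fun i => ?_⟩
    · ext v
      simpa using congrFun h0 v
    · rw [hfn]
      exact hle (hX i)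
  · rintro ⟨n, hn, hX⟩
    refine ⟨LinearMap.ker (dotProductBilin K K n), ?_, hX⟩
    have hf : dotProductBilin K K n ≠ 0 := fun h0 => hn <| by
      ext a
      simpa using LinearMap.congr_fun h0 (Pi.single a 1)
    have := Module.Dual.finrank_ker_add_one_of_ne_zero hf
    simp at this
    omega

theorem bracket₂_eq {ι : Type*} (V : ι → Fin 2 → K) (i j : ι) :
    bracket₂ V i j = V i 0 * V j 1 - V i 1 * V j 0 := by
  simp [bracket₂, Matrix.det_fin_two]

theorem bracket₃_eq {ι : Type*} (X : ι → Fin 3 → K) (i j l : ι) :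
    bracket₃ X i j l = X i 0 * X j 1 * X l 2 - X i 0 * X j 2 * X l 1 - X i 1 * X j 0 * X l 2
      + X i 1 * X j 2 * X l 0 + X i 2 * X j 0 * X l 1 - X i 2 * X j 1 * X l 0 := by
  simp [bracket₃, Matrix.det_fin_three]

open Matrix in
theorem bracket₃_eq_zero_iff {ι : Type*} (X : ι → Fin 3 → K) (i j l : ι) :
    bracket₃ X i j l = 0 ↔
      ∃ n : Fin 3 → K, n ≠ 0 ∧ n ⬝ᵥ X i = 0 ∧ n ⬝ᵥ X j = 0 ∧ n ⬝ᵥ X l = 0 := by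
  rw [bracket₃, ← Matrix.exists_mulVec_eq_zero_iff]
  simp [funext_iff, Fin.forall_fin_succ, dotProduct_comm]

/-- Every vector of three-space is a cross product. -/
theorem exists_crossProduct_eq (w : Fin 3 → K) : ∃ u v : Fin 3 → K, crossProduct u v = w := by
  by_cases h0 : w 0 = 0
  · by_cases h1 : w 1 = 0
    · exact ⟨![1, 0, 0], ![0, w 2, 0], by ext a; fin_cases a <;> simp [cross_apply, h0, h1]⟩
    · refine ⟨![0, -w 2 / w 1, 1], ![w 1, 0, 0], ?_⟩
      ext a; fin_cases a <;> (simp [cross_apply, h0]; try field_simp)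
  · refine ⟨![-w 1 / w 0, 1, 0], ![-w 2, 0, w 0], ?_⟩
    ext a; fin_cases a <;> (simp [cross_apply]; try field_simp)

/-! ### Homographies to the line `(*, *, 0)` and independence of their choice -/

/-- Every nonzero linear form is the last coordinate of a homography. -/
theorem exists_GL_row_two_eq {n : Fin 3 → K} (hn : n ≠ 0) :
    ∃ H : GL (Fin 3) K, H.val 2 = n := by
  have key (M : Matrix (Fin 3) (Fin 3) K) (h : M.det ≠ 0) (h2 : M 2 = n) :
      ∃ H : GL (Fin 3) K, H.val 2 = n := ⟨Matrix.GeneralLinearGroup.mkOfDetNeZero M h, h2⟩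
  by_cases h0 : n 0 = 0
  · by_cases h1 : n 1 = 0
    · refine key !![1, 0, 0; 0, 1, 0; n 0, n 1, n 2] ?_ ?_
      · intro h
        apply hn
        ext a
        fin_cases a <;> simp_all [Matrix.det_fin_three]
      · ext a; fin_cases a <;> simp
    · refine key !![1, 0, 0; 0, 0, 1; n 0, n 1, n 2] ?_ ?_
      · simpa [Matrix.det_fin_three] using h1
      · ext a; fin_cases a <;> simp
  · refine key !![0, 1, 0; 0, 0, 1; n 0, n 1, n 2] ?_ ?_
    · simpa [Matrix.det_fin_three] using h0
    · ext a; fin_cases a <;> simp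

theorem exists_flattens {ι : Type*} {p : ι → Projectivization K (Fin 3 → K)} {X : ι → Fin 3 → K}
    (h : Represents X p) (hp : OnLine p) : ∃ H : GL (Fin 3) K, Flattens H X := by
  obtain ⟨n, hn, hX⟩ := (onLine_iff h).1 hp
  obtain ⟨H, hH⟩ := exists_GL_row_two_eq hn
  exact ⟨H, fun i => by rw [Matrix.mulVec, hH, hX]⟩

open Matrix in
/-- The line bracket of flattened points is the scale of their cross product with respect to the
linear form that cuts out their common line. -/
theorem det_smul_crossProduct_eq {ι : Type*} {H : GL (Fin 3) K} {Y : ι → Fin 3 → K}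
    (h : Flattens H Y) (i j : ι) :
    H.val.det • crossProduct (Y i) (Y j) = bracket₂ (lineCoords H Y) i j • H.val 2 := by
  have hi := h i
  have hj := h j
  simp only [Matrix.mulVec, dotProduct, Fin.sum_univ_three] at hi hj
  have key : ∀ z : Fin 3 → K,
      (H.val.det • crossProduct (Y i) (Y j)) ⬝ᵥ z =
        (bracket₂ (lineCoords H Y) i j • H.val 2) ⬝ᵥ z := by
    intro z
    simp only [bracket₂_eq, lineCoords, Matrix.mulVec, dotProduct, Fin.sum_univ_three,
      Matrix.det_fin_three, cross_apply, Pi.smul_apply, smul_eq_mul, Matrix.cons_val]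
    generalize H.val = A at *
    -- The left side is the determinant with columns `H Yᵢ`, `H Yⱼ`, `H z`. Expanding it along the
    -- third coordinates leaves the right side plus multiples of the vanishing coordinates `hi` and
    -- `hj`, whose coefficients are 2×2 minors.
    linear_combination
      (-((A 0 0 * z 0 + A 0 1 * z 1 + A 0 2 * z 2) *
          (A 1 0 * Y j 0 + A 1 1 * Y j 1 + A 1 2 * Y j 2) -
        (A 1 0 * z 0 + A 1 1 * z 1 + A 1 2 * z 2) *
          (A 0 0 * Y j 0 + A 0 1 * Y j 1 + A 0 2 * Y j 2))) * hi +
      ((A 0 0 * z 0 + A 0 1 * z 1 + A 0 2 * z 2) *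
          (A 1 0 * Y i 0 + A 1 1 * Y i 1 + A 1 2 * Y i 2) -
        (A 1 0 * z 0 + A 1 1 * z 1 + A 1 2 * z 2) *
          (A 0 0 * Y i 0 + A 0 1 * Y i 1 + A 0 2 * Y i 2)) * hj
  exact dotProduct_eq _ _ key

theorem GL_det_ne_zero (H : GL (Fin 3) K) : H.val.det ≠ 0 :=
  ((Matrix.isUnit_iff_isUnit_det _).1 H.isUnit).ne_zero

theorem GL_row_two_ne_zero (H : GL (Fin 3) K) : H.val 2 ≠ 0 := fun h =>
  GL_det_ne_zero H (Matrix.det_eq_zero_of_row_eq_zero 2 fun j => congrFun h j)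

/-- Two identifications of a line with the projective line give proportional brackets. -/
theorem exists_bracket₂_lineCoords_eq {ι : Type*} {H H' : GL (Fin 3) K} {Y : ι → Fin 3 → K}
    (h : Flattens H Y) (h' : Flattens H' Y) : ∃ c : K, c ≠ 0 ∧
      ∀ i j, bracket₂ (lineCoords H Y) i j = c * bracket₂ (lineCoords H' Y) i j := by
  have key (i j) : (H'.val.det * bracket₂ (lineCoords H Y) i j) • H.val 2 =
      (H.val.det * bracket₂ (lineCoords H' Y) i j) • H'.val 2 := by
    rw [mul_smul, mul_smul, ← det_smul_crossProduct_eq h, ← det_smul_crossProduct_eq h', smul_comm]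
  have hd := GL_det_ne_zero H
  have hd' := GL_det_ne_zero H'
  have hr := GL_row_two_ne_zero H
  have hr' := GL_row_two_ne_zero H'
  -- If all brackets vanish for `H`, they vanish for `H'` too and any nonzero constant serves.
  -- Otherwise a nonzero bracket makes the third rows of `H` and `H'` proportional, and their ratio
  -- `s` determines the constant.
  by_cases h0 : ∀ i j, bracket₂ (lineCoords H Y) i j = 0
  · refine ⟨1, one_ne_zero, fun i j => ?_⟩
    have := key i j
    simp only [h0, mul_zero, zero_smul, eq_comm (a := (0 : Fin 3 → K)), smul_eq_zero, hr',
      or_false, mul_eq_zero, hd, false_or] at this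
    rw [h0, this, mul_zero]
  · push Not at h0
    obtain ⟨i, j, hij⟩ := h0
    have hs : H.val 2 = ((H'.val.det * bracket₂ (lineCoords H Y) i j)⁻¹ *
        (H.val.det * bracket₂ (lineCoords H' Y) i j)) • H'.val 2 := by
      rw [mul_smul, ← key i j, inv_smul_smul₀ (mul_ne_zero hd' hij)]
    generalize (H'.val.det * bracket₂ (lineCoords H Y) i j)⁻¹ *
        (H.val.det * bracket₂ (lineCoords H' Y) i j) = s at hs
    have hs0 : s ≠ 0 := by
      rintro rfl
      exact hr (by simpa using hs)
    refine ⟨H.val.det / (H'.val.det * s), div_ne_zero hd (mul_ne_zero hd' hs0), fun i j => ?_⟩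
    have hk := key i j
    rw [hs, smul_smul] at hk
    have := smul_left_injective K hr' hk
    field_simp
    linear_combination this

/-- Each side contains two line brackets, so both sides scale by `c ^ 2`. -/
theorem bracketEq_congr_scale {ι : Type*} (X : ι → Fin 3 → K) {V V' : ι → Fin 2 → K} {c : K}
    (hc : c ≠ 0) (h : ∀ i j, bracket₂ V i j = c * bracket₂ V' i j) (i₁ i₂ i₃ i₄ j : ι) :
    BracketEq X V i₁ i₂ i₃ i₄ j ↔ BracketEq X V' i₁ i₂ i₃ i₄ j := by
  simp only [BracketEq, h]
  rw [← mul_right_inj' (pow_ne_zero 2 hc)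
    (b := bracket₃ X i₁ i₃ j * bracket₃ X i₂ i₄ j * bracket₂ V' i₁ i₄ * bracket₂ V' i₂ i₃)]
  ring_nf

/-! ### Projection from a point and the Segre determinant -/

open Matrix in
/-- The Segre product of two quadruples on the projective line. -/
def segreMatrix {ι : Type*} (W V : ι → Fin 2 → K) (f : Fin 4 → ι) : Matrix (Fin 4) (Fin 4) K :=
  of fun k => ![W (f k) 0 * V (f k) 0, W (f k) 0 * V (f k) 1,
    W (f k) 1 * V (f k) 0, W (f k) 1 * V (f k) 1]

theorem segreMatrix_det {ι : Type*} (W V : ι → Fin 2 → K) (i₁ i₂ i₃ i₄ : ι) :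
    (segreMatrix W V ![i₁, i₂, i₃, i₄]).det =
      bracket₂ W i₁ i₄ * bracket₂ W i₂ i₃ * bracket₂ V i₁ i₃ * bracket₂ V i₂ i₄ -
        bracket₂ W i₁ i₃ * bracket₂ W i₂ i₄ * bracket₂ V i₁ i₄ * bracket₂ V i₂ i₃ := by
  simp only [bracket₂_eq]
  simp [segreMatrix, Matrix.det_succ_row_zero, Fin.sum_univ_succ, Fin.succAbove]
  ring

/-- Projection of the plane from the point `crossProduct u v`. -/
def projectFrom {ι : Type*} (u v : Fin 3 → K) (X : ι → Fin 3 → K) : ι → Fin 2 → K :=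
  fun i => ![dotProduct u (X i), dotProduct v (X i)]

/-- This is the identity `(u·x)(v·z) - (v·x)(u·z) = (u × v)·(x × z)`. -/
theorem bracket₂_projectFrom {ι : Type*} {u v : Fin 3 → K} {X : ι → Fin 3 → K} {j : ι}
    (h : crossProduct u v = X j) (i k : ι) :
    bracket₂ (projectFrom u v X) i k = bracket₃ X i k j := by
  rw [bracket₂_eq, bracket₃_eq, ← h]
  simp [projectFrom, cross_apply, dotProduct, Fin.sum_univ_three]
  ring

theorem bracketEq_iff_det_eq_zero {ι : Type*} {u v : Fin 3 → K} {X : ι → Fin 3 → K} {j : ι}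
    (h : crossProduct u v = X j) (V : ι → Fin 2 → K) (i₁ i₂ i₃ i₄ : ι) :
    BracketEq X V i₁ i₂ i₃ i₄ j ↔
      (segreMatrix (projectFrom u v X) V ![i₁, i₂, i₃, i₄]).det = 0 := by
  rw [segreMatrix_det, sub_eq_zero, eq_comm]
  simp only [bracket₂_projectFrom h, BracketEq]

theorem projectFrom_center {ι : Type*} {u v : Fin 3 → K} {X : ι → Fin 3 → K} {j : ι}
    (h : crossProduct u v = X j) (a : Fin 2) : projectFrom u v X j a = 0 := by
  fin_cases a <;> simp [projectFrom, ← h]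

theorem mem_of_nodup_five {i₁ i₂ i₃ i₄ j : Fin 5} (h : [i₁, i₂, i₃, i₄, j].Nodup) (i : Fin 5) :
    i = i₁ ∨ i = i₂ ∨ i = i₃ ∨ i = i₄ ∨ i = j := by
  have hinj : Function.Injective ![i₁, i₂, i₃, i₄, j] := by
    rw [← List.nodup_ofFn]
    simpa using h
  obtain ⟨k, rfl⟩ := Finite.injective_iff_surjective.1 hinj i
  fin_cases k <;> simp

/-- The bracket equation around `j` says that, after projection from the point with index `j`,
all the point pairs satisfy a common bilinear equation. -/
theorem bracketEq_iff_exists_form {u v : Fin 3 → K} {X : Fin 5 → Fin 3 → K} {j : Fin 5}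
    (h : crossProduct u v = X j) (V : Fin 5 → Fin 2 → K) {i₁ i₂ i₃ i₄ : Fin 5}
    (hn : [i₁, i₂, i₃, i₄, j].Nodup) :
    BracketEq X V i₁ i₂ i₃ i₄ j ↔ ∃ c : Fin 4 → K, c ≠ 0 ∧ ∀ i,
      projectFrom u v X i 0 * V i 0 * c 0 + projectFrom u v X i 0 * V i 1 * c 1 +
        projectFrom u v X i 1 * V i 0 * c 2 + projectFrom u v X i 1 * V i 1 * c 3 = 0 := by
  rw [bracketEq_iff_det_eq_zero h, ← Matrix.exists_mulVec_eq_zero_iff]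
  refine exists_congr fun c => and_congr_right fun _ => ?_
  constructor
  · intro h0
    have hk (k : Fin 4) := congrFun h0 k
    simp only [segreMatrix, Matrix.mulVec, dotProduct, Fin.sum_univ_four, Matrix.of_apply,
      Matrix.cons_val, Pi.zero_apply] at hk
    intro i
    rcases mem_of_nodup_five hn i with rfl | rfl | rfl | rfl | rfl
    · exact hk 0
    · exact hk 1
    · exact hk 2
    · exact hk 3
    · simp [projectFrom_center h]
  · intro h0
    ext k
    simpa [segreMatrix, Matrix.mulVec, dotProduct, Fin.sum_univ_four] using h0 _

/-- The criterion by a common bilinear form involves `j` but not the order of the other indices. -/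
theorem bracketEq_iff_of_nodup (X : Fin 5 → Fin 3 → K) (V : Fin 5 → Fin 2 → K)
    {i₁ i₂ i₃ i₄ i₁' i₂' i₃' i₄' j : Fin 5} (hn : [i₁, i₂, i₃, i₄, j].Nodup)
    (hn' : [i₁', i₂', i₃', i₄', j].Nodup) :
    BracketEq X V i₁ i₂ i₃ i₄ j ↔ BracketEq X V i₁' i₂' i₃' i₄' j := by
  obtain ⟨u, v, h⟩ := exists_crossProduct_eq (X j)
  rw [bracketEq_iff_exists_form h V hn, bracketEq_iff_exists_form h V hn']

/-- Projection from `X j` removes the term `j`; the other four coefficients give a relation between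
the rows of the Segre matrix. -/
theorem allBracketEqs_of_sum_eq_zero {X : Fin 5 → Fin 3 → K} {V : Fin 5 → Fin 2 → K} {g : Fin 5 → K}
    (hg : ∀ i, g i ≠ 0) (h : ∀ a b, ∑ i, g i * (X i a * V i b) = 0) : AllBracketEqs X V := by
  intro i₁ i₂ i₃ i₄ j hn
  obtain ⟨u, v, huv⟩ := exists_crossProduct_eq (X j)
  rw [bracketEq_iff_det_eq_zero huv, ← Matrix.exists_vecMul_eq_zero_iff]
  have huniv : (Finset.univ : Finset (Fin 5)) = {i₁, i₂, i₃, i₄, j} := by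
    ext i
    simpa using mem_of_nodup_five hn i
  have hproj (w : Fin 3 → K) (b) : ∑ i, g i * (dotProduct w (X i) * V i b) = 0 := by
    have : ∑ i, g i * (dotProduct w (X i) * V i b) =
        ∑ a, w a * ∑ i, g i * (X i a * V i b) := by
      simp_rw [dotProduct, Finset.mul_sum, Finset.sum_mul, Finset.mul_sum]
      rw [Finset.sum_comm]
      exact Finset.sum_congr rfl fun _ _ => Finset.sum_congr rfl fun _ _ => by ring
    simp [this, h]
  have hW (a b) : g i₁ * (projectFrom u v X i₁ a * V i₁ b) +
      g i₂ * (projectFrom u v X i₂ a * V i₂ b) + g i₃ * (projectFrom u v X i₃ a * V i₃ b) +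
      g i₄ * (projectFrom u v X i₄ a * V i₄ b) = 0 := by
    have h0 : ∑ i, g i * (projectFrom u v X i a * V i b) = 0 := by
      fin_cases a
      · exact hproj u b
      · exact hproj v b
    simp only [List.nodup_cons, List.mem_cons, not_or, List.not_mem_nil] at hn
    rw [huniv, Finset.sum_insert (by simp; tauto), Finset.sum_insert (by simp; tauto),
      Finset.sum_insert (by simp; tauto), Finset.sum_insert (by simp; tauto),
      Finset.sum_singleton, projectFrom_center huv] at h0
    linear_combination h0
  refine ⟨![g i₁, g i₂, g i₃, g i₄], fun h0 => hg i₁ (congrFun h0 0), ?_⟩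
  ext k
  fin_cases k <;>
    simp [Matrix.vecMul, dotProduct, Fin.sum_univ_four, segreMatrix, hW]

/-! ### From the bracket equations to linear dependence -/

/-- The matrix of products of the coordinates of points of the plane and of the line. -/
def planeLineMatrix {ι : Type*} (X : ι → Fin 3 → K) (V : ι → Fin 2 → K) :
    Matrix ι (Fin 3 × Fin 2) K :=
  Matrix.of fun i c => X i c.1 * V i c.2

theorem planeLineMatrix_mulVec {ι : Type*} (X : ι → Fin 3 → K) (V : ι → Fin 2 → K)
    (B : Fin 3 × Fin 2 → K) (i : ι) :
    (planeLineMatrix X V).mulVec B i = ∑ b, (∑ a, X i a * B (a, b)) * V i b := by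
  simp [planeLineMatrix, Matrix.mulVec, dotProduct, Fintype.sum_prod_type, Fin.sum_univ_three]
  ring

/-- The bracket equation around `j` gives a bilinear equation of all the point pairs that is
singular at the point with index `j`. -/
theorem exists_singular_form_of_bracketEq {X : Fin 5 → Fin 3 → K} {V : Fin 5 → Fin 2 → K}
    {i₁ i₂ i₃ i₄ j : Fin 5} (hj : X j ≠ 0) (hn : [i₁, i₂, i₃, i₄, j].Nodup)
    (h : BracketEq X V i₁ i₂ i₃ i₄ j) :
    ∃ B : Fin 3 × Fin 2 → K, B ≠ 0 ∧ (planeLineMatrix X V).mulVec B = 0 ∧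
      ∀ b, ∑ a, X j a * B (a, b) = 0 := by
  obtain ⟨u, v, huv⟩ := exists_crossProduct_eq (X j)
  obtain ⟨c, hc, h0⟩ := (bracketEq_iff_exists_form huv V hn).1 h
  have hpair : LinearIndependent K ![u, v] := by
    rw [← crossProduct_ne_zero_iff_linearIndependent, huv]
    exact hj
  rw [LinearIndependent.pair_iff] at hpair
  have hX (i : Fin 5) (s t : K) : ∑ a, X i a * (u a * s + v a * t) =
      projectFrom u v X i 0 * s + projectFrom u v X i 1 * t := by
    simp [projectFrom, dotProduct, Fin.sum_univ_three]
    ring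
  -- The form `c` pulled back along the projection. It stays nonzero because `u` and `v` are
  -- independent, their cross product being `X j ≠ 0`.
  refine ⟨fun p => u p.1 * ![c 0, c 1] p.2 + v p.1 * ![c 2, c 3] p.2, fun hB => hc ?_, ?_,
    fun b => ?_⟩
  · have hb (b : Fin 2) := hpair (![c 0, c 1] b) (![c 2, c 3] b) (by
      ext a
      simpa [mul_comm] using congrFun hB (a, b))
    have hb0 := hb 0
    have hb1 := hb 1
    simp only [Matrix.cons_val] at hb0 hb1
    ext k
    fin_cases k
    · exact hb0.1
    · exact hb1.1
    · exact hb0.2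
    · exact hb1.2
  · ext i
    simp only [planeLineMatrix_mulVec, hX, Fin.sum_univ_two, Matrix.cons_val, Pi.zero_apply]
    linear_combination h0 i
  · simp only [hX, projectFrom_center huv, zero_mul, add_zero]

/-- If the bracket equations hold, the products of coordinates are linearly dependent. -/
theorem planeLineMatrix_rank_lt {X : Fin 5 → Fin 3 → K} {V : Fin 5 → Fin 2 → K}
    (hX : ∀ i, X i ≠ 0) (h : AllBracketEqs X V) : (planeLineMatrix X V).rank < 5 := by
  by_contra! hrank
  -- There are six columns, so rank at least 5 leaves a kernel of dimension at most one.
  have hcard : Fintype.card (Fin 3 × Fin 2) ≤ (planeLineMatrix X V).rank + 1 := by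
    simp
    omega
  have hform (j : Fin 5) : ∃ B : Fin 3 × Fin 2 → K, B ≠ 0 ∧
      (planeLineMatrix X V).mulVec B = 0 ∧ ∀ b, ∑ a, X j a * B (a, b) = 0 := by
    -- Addition is modulo 5, so this is one ordering of the other indices for each `j`.
    have hn : ∀ j : Fin 5, [j + 1, j + 2, j + 3, j + 4, j].Nodup := by decide
    exact exists_singular_form_of_bracketEq (hX j) (hn j) (h _ _ _ _ _ (hn j))
  obtain ⟨B, hB, hMB, -⟩ := hform 0
  -- `B` is a multiple of the form that is singular at `X j`, so it inherits the singularity, for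
  -- every `j`.
  have hsing (j : Fin 5) (b : Fin 2) : ∑ a, X j a * B (a, b) = 0 := by
    obtain ⟨B', hB', hMB', hj⟩ := hform j
    obtain ⟨c, rfl⟩ := exists_smul_eq_of_mulVec_eq_zero hcard hB' hMB' hMB
    simp only [Pi.smul_apply, smul_eq_mul, mul_left_comm _ c, ← Finset.mul_sum, hj, mul_zero]
  obtain ⟨⟨a₀, b₀⟩, hab⟩ := Function.ne_iff.1 hB
  -- The column `b₀` of `B` is nonzero and annihilates every `X i`, so its product with any `w` lies
  -- in the kernel. Two independent choices of `w` contradict the dimension bound.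
  have hker (w : Fin 2 → K) :
      (planeLineMatrix X V).mulVec (fun p => B (p.1, b₀) * w p.2) = 0 := by
    ext i
    simp only [planeLineMatrix_mulVec, ← mul_assoc, ← Finset.sum_mul, hsing, zero_mul,
      Finset.sum_const_zero, Pi.zero_apply]
  obtain ⟨c, hc⟩ := exists_smul_eq_of_mulVec_eq_zero hcard
    (fun h0 => hab (by simpa using congrFun h0 (a₀, 0))) (hker ![1, 0]) (hker ![0, 1])
  exact hab (by simpa using (congrFun hc (a₀, 1)).symm)

/-! ### Passing between plane and line coordinates; the rank criterion -/

theorem sum_lineCoords_eq_zero {ι : Type*} [Fintype ι] {X Y : ι → Fin 3 → K} {g : ι → K}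
    (H : GL (Fin 3) K) (h : ∀ a b, ∑ i, g i * (X i a * Y i b) = 0) (a : Fin 3) (b : Fin 2) :
    ∑ i, g i * (X i a * lineCoords H Y i b) = 0 := by
  have hrow (r : Fin 3) : ∑ i, g i * (X i a * H.val.mulVec (Y i) r) = 0 := by
    have : ∑ i, g i * (X i a * H.val.mulVec (Y i) r) =
        ∑ b, H.val r b * ∑ i, g i * (X i a * Y i b) := by
      simp_rw [Matrix.mulVec, dotProduct, Finset.mul_sum]
      rw [Finset.sum_comm]
      exact Finset.sum_congr rfl fun _ _ => Finset.sum_congr rfl fun _ _ => by ring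
    simp [this, h]
  fin_cases b
  · exact hrow 0
  · exact hrow 1

/-- The dropped third coordinate vanishes, so the relation holds for all coordinates of `H Y` and
can be carried back by the inverse of `H`. -/
theorem sum_eq_zero_of_lineCoords {ι : Type*} [Fintype ι] {X Y : ι → Fin 3 → K} {g : ι → K}
    {H : GL (Fin 3) K} (hH : Flattens H Y)
    (h : ∀ a b, ∑ i, g i * (X i a * lineCoords H Y i b) = 0) (a b : Fin 3) :
    ∑ i, g i * (X i a * Y i b) = 0 := by
  have hrow (r : Fin 3) : ∑ i, g i * (X i a * H.val.mulVec (Y i) r) = 0 := by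
    fin_cases r
    · exact h a 0
    · exact h a 1
    · exact Finset.sum_eq_zero fun i _ => by
        have := hH i
        simp_all
  have hY (i : ι) : Y i b = ∑ r, H⁻¹.val b r * H.val.mulVec (Y i) r := by
    have : H⁻¹.val.mulVec (H.val.mulVec (Y i)) = Y i := by
      rw [Matrix.mulVec_mulVec, Units.inv_mul, Matrix.one_mulVec]
    exact (congrFun this b).symm
  have : ∑ i, g i * (X i a * Y i b) =
      ∑ r, H⁻¹.val b r * ∑ i, g i * (X i a * H.val.mulVec (Y i) r) := by
    simp_rw [hY, Finset.mul_sum]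
    rw [Finset.sum_comm]
    exact Finset.sum_congr rfl fun _ _ => Finset.sum_congr rfl fun _ _ => by ring
  simp [this, hrow]

theorem faceSplit_rank_lt_of_allBracketEqs {X Y : Fin 5 → Fin 3 → K} (hX : ∀ i, X i ≠ 0)
    {H : GL (Fin 3) K} (hH : Flattens H Y) (h : AllBracketEqs X (lineCoords H Y)) :
    (faceSplit X Y).rank < 5 := by
  have hr := planeLineMatrix_rank_lt hX h
  obtain ⟨g, hg, h0⟩ := (rank_lt_card_iff_exists_vecMul _).1 (by rwa [Fintype.card_fin])
  refine (faceSplit_rank_lt_five_iff_exists X Y).2 ⟨g, hg, sum_eq_zero_of_lineCoords hH fun a b => ?_⟩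
  simpa [Matrix.vecMul, dotProduct, planeLineMatrix] using congrFun h0 (a, b)

open Matrix in
/-- A relation without zero coefficients among five products of vectors forces one of the two
families to be contained in a plane. -/
theorem exists_annihilator_of_sum_eq_zero {X Y : Fin 5 → Fin 3 → K} {g : Fin 5 → K}
    (hg : ∀ i, g i ≠ 0) (h : ∀ a b, ∑ i, g i * (X i a * Y i b) = 0) :
    (∃ n : Fin 3 → K, n ≠ 0 ∧ ∀ i, n ⬝ᵥ Y i = 0) ∨ ∃ n : Fin 3 → K, n ≠ 0 ∧ ∀ i, n ⬝ᵥ X i = 0 := by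
  have hmul : (of X)ᵀ * (diagonal g * of Y) = 0 := by
    ext a b
    rw [Matrix.zero_apply, ← h a b, Matrix.mul_apply]
    exact Finset.sum_congr rfl fun i _ => by simp [Matrix.diagonal_mul]; ring
  -- Since `diagonal g` is invertible, the ranks of `X` and `Y` sum to at most 5, so they cannot
  -- both be 3.
  have hrank := Matrix.rank_add_rank_le_card_of_mul_eq_zero hmul
  rw [Matrix.rank_mul_eq_right_of_det_ne_zero (diagonal g) (of Y) (by
    simpa [Matrix.det_diagonal, Finset.prod_eq_zero_iff] using hg), Matrix.rank_transpose,
    Fintype.card_fin] at hrank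
  have key (Z : Fin 5 → Fin 3 → K) (hZ : (of Z).rank < 3) :
      ∃ n : Fin 3 → K, n ≠ 0 ∧ ∀ i, n ⬝ᵥ Z i = 0 := by
    obtain ⟨n, hn, h0⟩ := (rank_lt_card_iff_exists_mulVec (of Z)).1 (by simpa using hZ)
    exact ⟨n, hn, fun i => by rw [dotProduct_comm]; exact congrFun h0 i⟩
  rcases lt_or_ge (of Y).rank 3 with hY | hY
  · exact Or.inl (key Y hY)
  · exact Or.inr (key X (by omega))

theorem faceSplit_rank_lt_five_iff {x y : Fin 5 → Projectivization K (Fin 3 → K)}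
    {X Y : Fin 5 → Fin 3 → K} (hx : Represents X x) (hy : Represents Y y) :
    (faceSplit X Y).rank < 5 ↔
      Inherited X Y ∨
      (OnLine y ∧ ∃ H : GL (Fin 3) K, Flattens H Y ∧ AllBracketEqs X (lineCoords H Y)) ∨
      (OnLine x ∧ ∃ H : GL (Fin 3) K, Flattens H X ∧ AllBracketEqs Y (lineCoords H X)) := by
  constructor
  · intro h
    by_cases hinh : Inherited X Y
    · exact Or.inl hinh
    obtain ⟨g, hg, h0⟩ := (faceSplit_rank_lt_five_iff_exists X Y).1 h
    have hg' (i : Fin 5) : g i ≠ 0 := fun hi =>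
      hinh ((inherited_iff X Y).2 ⟨g, hg, ⟨i, hi⟩, h0⟩)
    have h0' (a b) : ∑ i, g i * (Y i a * X i b) = 0 := by
      simpa only [mul_comm (X _ _)] using h0 b a
    refine Or.inr ?_
    rcases exists_annihilator_of_sum_eq_zero hg' h0 with hn | hn
    · have hl := (onLine_iff hy).2 hn
      obtain ⟨H, hH⟩ := exists_flattens hy hl
      exact Or.inl ⟨hl, H, hH, allBracketEqs_of_sum_eq_zero hg' (sum_lineCoords_eq_zero H h0)⟩
    · have hl := (onLine_iff hx).2 hn
      obtain ⟨H, hH⟩ := exists_flattens hx hl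
      exact Or.inr ⟨hl, H, hH, allBracketEqs_of_sum_eq_zero hg' (sum_lineCoords_eq_zero H h0')⟩
  · rintro (h | ⟨-, H, hH, h⟩ | ⟨-, H, hH, h⟩)
    · obtain ⟨g, hg, -, h0⟩ := (inherited_iff X Y).1 h
      exact (faceSplit_rank_lt_five_iff_exists X Y).2 ⟨g, hg, h0⟩
    · exact faceSplit_rank_lt_of_allBracketEqs (fun i => (hx i).1) hH h
    · obtain ⟨g, hg, h0⟩ := (faceSplit_rank_lt_five_iff_exists Y X).1
        (faceSplit_rank_lt_of_allBracketEqs (fun i => (hy i).1) hH h)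
      exact (faceSplit_rank_lt_five_iff_exists X Y).2
        ⟨g, hg, fun a b => by simpa only [mul_comm (Y _ _)] using h0 b a⟩

/-! ### Collinear and generic configurations, cross-ratios -/

theorem bracket₃_eq_zero_of_onLine {ι : Type*} {x : ι → Projectivization K (Fin 3 → K)}
    {X : ι → Fin 3 → K} (hx : Represents X x) (h : OnLine x) (i j l : ι) :
    bracket₃ X i j l = 0 := by
  obtain ⟨n, hn, h0⟩ := (onLine_iff hx).1 h
  exact (bracket₃_eq_zero_iff X i j l).2 ⟨n, hn, h0 i, h0 j, h0 l⟩

theorem Represents.triple {ι : Type*} {x : ι → Projectivization K (Fin 3 → K)}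
    {X : ι → Fin 3 → K} (hx : Represents X x) (i j l : ι) :
    Represents ![X i, X j, X l] ![x i, x j, x l] := by
  intro k
  fin_cases k
  · exact hx i
  · exact hx j
  · exact hx l

theorem onLine_triple_iff {ι : Type*} {x : ι → Projectivization K (Fin 3 → K)}
    {X : ι → Fin 3 → K} (hx : Represents X x) (i j l : ι) :
    OnLine ![x i, x j, x l] ↔ bracket₃ X i j l = 0 := by
  rw [onLine_iff (hx.triple i j l), bracket₃_eq_zero_iff]
  simp [Fin.forall_fin_succ]

/-- By `det_smul_crossProduct_eq`, a zero bracket makes the cross product vanish, and then the two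
points coincide. -/
theorem bracket₂_lineCoords_ne_zero {ι : Type*} {y : ι → Projectivization K (Fin 3 → K)}
    {Y : ι → Fin 3 → K} (hy : Represents Y y) {H : GL (Fin 3) K} (hH : Flattens H Y) {i j : ι}
    (hij : y i ≠ y j) : bracket₂ (lineCoords H Y) i j ≠ 0 := by
  intro h0
  have hc := det_smul_crossProduct_eq hH i j
  rw [h0, zero_smul, smul_eq_zero, or_iff_right (GL_det_ne_zero H)] at hc
  obtain ⟨hi, hyi⟩ := hy i
  obtain ⟨hj, hyj⟩ := hy j
  have hdep : ¬ LinearIndependent K ![Y j, Y i] := by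
    rw [← crossProduct_ne_zero_iff_linearIndependent, ← cross_anticomm, hc]
    simp
  rw [LinearIndependent.pair_iff' hj] at hdep
  push Not at hdep
  apply hij
  rw [← hyi, ← hyj, Projectivization.mk_eq_mk_iff']
  exact hdep

theorem bracketEq_iff_crossRatio_eq {x y : Fin 5 → Projectivization K (Fin 3 → K)}
    {X Y : Fin 5 → Fin 3 → K} (hx : Represents X x) (hy : Represents Y y) {H : GL (Fin 3) K}
    (hH : Flattens H Y) (hgen : Generic x y) {i₁ i₂ i₃ i₄ j : Fin 5}
    (hn : [i₁, i₂, i₃, i₄, j].Nodup) :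
    BracketEq X (lineCoords H Y) i₁ i₂ i₃ i₄ j ↔
      planarCrossRatio X i₁ i₂ i₃ i₄ j = lineCrossRatio (lineCoords H Y) i₁ i₂ i₃ i₄ := by
  have hX (i k l : Fin 5) (h : [i, k, l].Nodup) : bracket₃ X i k l ≠ 0 := fun h0 =>
    hgen.1 i k l h ((onLine_triple_iff hx i k l).2 h0)
  have hY (i k : Fin 5) (h : i ≠ k) : bracket₂ (lineCoords H Y) i k ≠ 0 :=
    bracket₂_lineCoords_ne_zero hy hH fun h' => h (hgen.2 h')
  simp only [List.nodup_cons, List.mem_cons, not_or, List.not_mem_nil] at hn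
  rw [planarCrossRatio, lineCrossRatio, div_eq_div_iff
    (mul_ne_zero (hX _ _ _ (by simp; tauto)) (hX _ _ _ (by simp; tauto)))
    (mul_ne_zero (hY _ _ (by tauto)) (hY _ _ (by tauto))), BracketEq]
  ring_nf

/-- In characteristic zero there are five points of the plane, no three on a line, and five
distinct points on a line. -/
theorem exists_generic_onLine [CharZero K] :
    ∃ x y : Fin 5 → Projectivization K (Fin 3 → K), OnLine y ∧ Generic x y := by
  -- The `x_i` are points `(1, t, t²)` of a conic, whose brackets are Vandermonde determinants; the
  -- `y_i` are points `(1, t, 0)` of a line. Characteristic zero keeps the parameters `t = 0, …, 4`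
  -- distinct.
  have hX (i : Fin 5) : (![1, (i : ℕ), (i : ℕ) ^ 2] : Fin 3 → K) ≠ 0 := fun h => by
    simpa using congrFun h 0
  have hY (i : Fin 5) : (![1, (i : ℕ), 0] : Fin 3 → K) ≠ 0 := fun h => by
    simpa using congrFun h 0
  have hcast {i k : Fin 5} (h : ((i : ℕ) : K) = ((k : ℕ) : K)) : i = k :=
    Fin.ext (Nat.cast_injective h)
  refine ⟨fun i => Projectivization.mk K _ (hX i), fun i => Projectivization.mk K _ (hY i), ?_,
    fun i k l hn => ?_, fun i k h => ?_⟩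
  · rw [onLine_iff (fun i => ⟨hY i, rfl⟩)]
    refine ⟨![0, 0, 1], fun h => by simpa using congrFun h 2, fun i => by simp⟩
  · rw [onLine_triple_iff (x := fun i => Projectivization.mk K _ (hX i)) (fun i => ⟨hX i, rfl⟩)]
    have hdet : bracket₃ (fun i : Fin 5 => (![1, (i : ℕ), (i : ℕ) ^ 2] : Fin 3 → K)) i k l =
        ((k : ℕ) - (i : ℕ)) * ((l : ℕ) - (i : ℕ)) * ((l : ℕ) - (k : ℕ)) := by
      rw [bracket₃_eq]
      simp
      ring
    simp only [List.nodup_cons, List.mem_cons, not_or, List.not_mem_nil] at hn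
    rw [hdet]
    refine mul_ne_zero (mul_ne_zero ?_ ?_) ?_ <;> refine sub_ne_zero.2 fun h => ?_ <;>
      have := hcast h <;> simp_all
  · rw [Projectivization.mk_eq_mk_iff'] at h
    obtain ⟨a, ha⟩ := h
    have h0 := congrFun ha 0
    have h1 := congrFun ha 1
    simp at h0 h1
    rw [h0, one_mul] at h1
    exact (hcast h1).symm

end Field

theorem theorem5p1 {𝕜 : Type*} [RCLike 𝕜] :
    -- the statements about an arbitrary configuration and arbitrary coordinate vectors
    (∀ (x y : Fin 5 → Projectivization 𝕜 (Fin 3 → 𝕜)) (X Y : Fin 5 → Fin 3 → 𝕜),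
      Represents X x → Represents Y y →
      -- characterization of rank deficiency
      ((faceSplit X Y).rank < 5 ↔
        Inherited X Y ∨
        (OnLine y ∧ ∃ H : GL (Fin 3) 𝕜, Flattens H Y ∧ AllBracketEqs X (lineCoords H Y)) ∨
        (OnLine x ∧ ∃ H : GL (Fin 3) 𝕜, Flattens H X ∧ AllBracketEqs Y (lineCoords H X))) ∧
      -- the equations do not depend on the identification of the line with the projective line
      (∀ H H' : GL (Fin 3) 𝕜, Flattens H Y → Flattens H' Y →
        ∀ i₁ i₂ i₃ i₄ j : Fin 5, [i₁, i₂, i₃, i₄, j].Nodup →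
          (BracketEq X (lineCoords H Y) i₁ i₂ i₃ i₄ j ↔
            BracketEq X (lineCoords H' Y) i₁ i₂ i₃ i₄ j)) ∧
      (∀ H : GL (Fin 3) 𝕜, Flattens H Y →
        -- for each `j` the equations for all orders of the other four indices are equivalent
        (∀ i₁ i₂ i₃ i₄ i₁' i₂' i₃' i₄' j : Fin 5,
          [i₁, i₂, i₃, i₄, j].Nodup → [i₁', i₂', i₃', i₄', j].Nodup →
          (BracketEq X (lineCoords H Y) i₁ i₂ i₃ i₄ j ↔
            BracketEq X (lineCoords H Y) i₁' i₂' i₃' i₄' j)) ∧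
        -- if both sides are collinear, all equations hold
        (OnLine x → AllBracketEqs X (lineCoords H Y)) ∧
        -- generically, the equations are equalities of cross-ratios
        (Generic x y → ∀ i₁ i₂ i₃ i₄ j : Fin 5, [i₁, i₂, i₃, i₄, j].Nodup →
          (BracketEq X (lineCoords H Y) i₁ i₂ i₃ i₄ j ↔
            planarCrossRatio X i₁ i₂ i₃ i₄ j = lineCrossRatio (lineCoords H Y) i₁ i₂ i₃ i₄)))) ∧
    -- generic configurations with one side collinear exist
    (∃ x y : Fin 5 → Projectivization 𝕜 (Fin 3 → 𝕜), OnLine y ∧ Generic x y) := by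
  refine ⟨fun x y X Y hx hy => ⟨faceSplit_rank_lt_five_iff hx hy, ?_, fun H hH => ⟨?_, ?_, ?_⟩⟩,
    exists_generic_onLine⟩
  · intro H H' hH hH' i₁ i₂ i₃ i₄ j _
    obtain ⟨c, hc, h⟩ := exists_bracket₂_lineCoords_eq hH hH'
    exact bracketEq_congr_scale X hc h i₁ i₂ i₃ i₄ j
  · intro i₁ i₂ i₃ i₄ i₁' i₂' i₃' i₄' j hn hn'
    exact bracketEq_iff_of_nodup X _ hn hn'
  · intro hl i₁ i₂ i₃ i₄ j _
    simp [BracketEq, bracket₃_eq_zero_of_onLine hx hl]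
  · intro hgen i₁ i₂ i₃ i₄ j hn
    exact bracketEq_iff_crossRatio_eq hx hy hH hgen hn
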